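/- Let $(B_0,B_1)$ be an interpolation couple, that is, two (real or complex) Banach spaces $B_0$ and $B_1$ over the same scalar field, each continuously and linearly embedded in a common Hausdorff topological vector space. For $t>0$ and $a\in B_0+B_1$ put $$K(t,a)=\inf\{\|a_0\|_{B_0}+t\|a_1\|_{B_1}\;:\;a=a_0+a_1,\ a_0\in B_0,\ a_1\in B_1\},$$ and for $0<\theta<1$, $1<p<\infty$ let $B_{\theta,p}$ be the real interpolation space $$B_{\theta,p}=\Big\{a\in B_0+B_1\;:\;\|a\|_{B_{\theta,p}}=\Big[\int_0^\infty\Big(\frac{K(t,a)}{t^{\theta}}\Big)^{p}\frac{dt}{t}\Big]^{1/p}<\infty\Big\}.$$ A norm $\|\cdot\|$ on a space $X$ is called uniformly rotund (UR) if $\|x_n-y_n\|\to 0$ for all sequences $(x_n),(y_n)$ in $X$ with $\|x_n\|=\|y_n\|=1$ for all $n$ and $\|x_n+y_n\|\to 2$. Theorem. Let $(B_0,B_1)$ be an interpolation couple, let $0<\theta<1$ and let $1<p<\infty$. If the norm of $B_0$ is UR, then $B_{\theta,p}$ admits an equivalent UR norm, i.e. there are a norm $N$ on $B_{\theta,p}$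 which is UR and constants $c,C>0$ with $c\,\|a\|_{B_{\theta,p}}\le N(a)\le C\,\|a\|_{B_{\theta,p}}$ for all $a\in B_{\theta,p}$. -/

import Mathlib

open scoped ENNReal

/-- The norm `N` on `X` is *uniformly rotund* (UR): if `x n`, `y n` lie on its unit sphere and
`N (x n + y n) → 2`, then `N (x n - y n) → 0`. -/
def UniformlyRotund {𝕜 X : Type*} [RCLike 𝕜] [AddCommGroup X] [Module 𝕜 X]
    (N : Seminorm 𝕜 X) : Prop :=
  ∀ x y : ℕ → X, (∀ n, N (x n) = 1) → (∀ n, N (y n) = 1) →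
    Filter.Tendsto (fun n => N (x n + y n)) Filter.atTop (nhds 2) →
    Filter.Tendsto (fun n => N (x n - y n)) Filter.atTop (nhds 0)

/-- For the norm of a normed space, uniform rotundity is Mathlib's uniform convexity. -/
theorem uniformlyRotund_normSeminorm_iff {𝕜 X : Type*} [RCLike 𝕜] [NormedAddCommGroup X]
    [NormedSpace 𝕜 X] : UniformlyRotund (normSeminorm 𝕜 X) ↔ UniformConvexSpace X := by
  simp only [UniformlyRotund, coe_normSeminorm]
  constructor
  · intro h
    refine ⟨fun ε hε => ?_⟩
    by_contra! hcon
    have hpos : ∀ n : ℕ, (0 : ℝ) < 1 / ((n : ℝ) + 1) := fun n => by positivity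
    choose x hx y hy hxy hsum using fun n : ℕ => hcon _ (hpos n)
    have hlim : Filter.Tendsto (fun n => ‖x n + y n‖) Filter.atTop (nhds 2) := by
      refine tendsto_of_tendsto_of_tendsto_of_le_of_le
        (g := fun n : ℕ => (2 : ℝ) - 1 / ((n : ℝ) + 1)) (h := fun _ => (2 : ℝ)) ?_
        tendsto_const_nhds (fun n => (hsum n).le) (fun n => ?_)
      · simpa using tendsto_const_nhds.sub (tendsto_one_div_add_atTop_nhds_zero_nat (𝕜 := ℝ))
      · exact (norm_add_le _ _).trans (by rw [hx, hy]; norm_num)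
    have := ge_of_tendsto' (h x y hx hy hlim) hxy
    linarith
  · intro h x y hx hy hlim
    rw [Metric.tendsto_atTop]
    intro ε hε
    obtain ⟨δ, hδ, H⟩ := h.uniform_convex hε
    obtain ⟨n₀, hn₀⟩ := Filter.eventually_atTop.1
      (hlim.eventually_const_lt (show (2 : ℝ) - δ < 2 by linarith))
    refine ⟨n₀, fun n hn => ?_⟩
    rw [Real.dist_eq, sub_zero, abs_norm]
    by_contra! hcon
    exact absurd (H (hx n) (hy n) hcon) (not_le.2 (hn₀ n hn))

/-- An *interpolation couple*: normed spaces `B₀` and `B₁` (Banach spaces in the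
applications), both embedded linearly and continuously in the topological vector space `V`
(Hausdorff in the applications). -/
structure InterpolationCouple (𝕜 B₀ B₁ V : Type*) [RCLike 𝕜]
    [NormedAddCommGroup B₀] [NormedSpace 𝕜 B₀] [NormedAddCommGroup B₁] [NormedSpace 𝕜 B₁]
    [AddCommGroup V] [Module 𝕜 V] [TopologicalSpace V] where
  incl₀ : B₀ →L[𝕜] V
  incl₁ : B₁ →L[𝕜] V
  injective_incl₀ : Function.Injective incl₀
  injective_incl₁ : Function.Injective incl₁

namespace InterpolationCouple

variable {𝕜 B₀ B₁ V : Type*} [RCLike 𝕜]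
  [NormedAddCommGroup B₀] [NormedSpace 𝕜 B₀] [NormedAddCommGroup B₁] [NormedSpace 𝕜 B₁]
  [AddCommGroup V] [Module 𝕜 V] [TopologicalSpace V]

/-- The space `B₀ + B₁`, inside `V`. -/
def sumSpace (B : InterpolationCouple 𝕜 B₀ B₁ V) : Submodule 𝕜 V :=
  LinearMap.range B.incl₀.toLinearMap ⊔ LinearMap.range B.incl₁.toLinearMap

/-- The functional `K(t, a) = inf { ‖a₀‖ + t ‖a₁‖ ; a = a₀ + a₁, a₀ ∈ B₀, a₁ ∈ B₁ }`. -/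
noncomputable def K (B : InterpolationCouple 𝕜 B₀ B₁ V) (t : ℝ) (a : V) : ℝ≥0∞ :=
  ⨅ (x : B₀ × B₁) (_ : B.incl₀ x.1 + B.incl₁ x.2 = a), ‖x.1‖ₑ + ENNReal.ofReal t * ‖x.2‖ₑ

/-- The quantity `(∫₀^∞ (K(t, a) / t ^ θ) ^ p dt / t) ^ (1 / p)`, possibly infinite. -/
noncomputable def interpENorm (B : InterpolationCouple 𝕜 B₀ B₁ V) (θ p : ℝ) (a : V) : ℝ≥0∞ :=
  (∫⁻ t in Set.Ioi (0 : ℝ),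
    (B.K t a / ENNReal.ofReal (t ^ θ)) ^ p / ENNReal.ofReal t) ^ (1 / p)

theorem K_zero (B : InterpolationCouple 𝕜 B₀ B₁ V) (t : ℝ) : B.K t 0 = 0 := by
  refine le_antisymm ?_ bot_le
  exact (iInf₂_le (0 : B₀ × B₁) (by simp)).trans (by simp)

theorem K_add_le (B : InterpolationCouple 𝕜 B₀ B₁ V) (t : ℝ) (a b : V) :
    B.K t (a + b) ≤ B.K t a + B.K t b := by
  conv_rhs => simp only [K, ENNReal.iInf_add, ENNReal.add_iInf]
  refine le_iInf₂ fun x hx => le_iInf₂ fun y hy => ?_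
  refine (iInf₂_le (x + y) ?_).trans ?_
  · rw [← hx, ← hy]
    simp only [Prod.fst_add, Prod.snd_add, map_add]
    abel
  · calc ‖(x + y).1‖ₑ + ENNReal.ofReal t * ‖(x + y).2‖ₑ
        ≤ (‖x.1‖ₑ + ‖y.1‖ₑ) + ENNReal.ofReal t * (‖x.2‖ₑ + ‖y.2‖ₑ) := by
          gcongr
          · exact enorm_add_le _ _
          · exact enorm_add_le _ _
      _ = _ := by ring

theorem K_smul_le (B : InterpolationCouple 𝕜 B₀ B₁ V) (t : ℝ) (c : 𝕜) (a : V) :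
    B.K t (c • a) ≤ ‖c‖ₑ * B.K t a := by
  rcases eq_or_ne c 0 with rfl | hc
  · simp [K_zero]
  have hc0 : ‖c‖ₑ ≠ 0 := by simpa using hc
  simp only [K, ENNReal.mul_iInf_of_ne hc0 enorm_ne_top]
  refine le_iInf₂ fun x hx => (iInf₂_le (c • x) ?_).trans (le_of_eq ?_)
  · rw [← hx]
    simp
  · simp only [Prod.smul_fst, Prod.smul_snd, enorm_smul]
    ring

theorem K_mono (B : InterpolationCouple 𝕜 B₀ B₁ V) (a : V) : Monotone fun t => B.K t a := by
  intro s t hst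
  refine iInf₂_mono fun x _ => ?_
  gcongr

theorem interpENorm_lt_top_iff (B : InterpolationCouple 𝕜 B₀ B₁ V) (θ : ℝ) {p : ℝ} (hp : 1 ≤ p)
    (a : V) : B.interpENorm θ p a < ∞ ↔ ∫⁻ t in Set.Ioi (0 : ℝ),
      (B.K t a / ENNReal.ofReal (t ^ θ)) ^ p / ENNReal.ofReal t < ∞ :=
  ENNReal.rpow_lt_top_iff_of_pos (by positivity)

/-- The real interpolation space `B_{θ,p}`: all `a ∈ B₀ + B₁` for which
`(∫₀^∞ (K(t, a) / t ^ θ) ^ p dt / t) ^ (1 / p)` is finite. -/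
noncomputable def realInterp (B : InterpolationCouple 𝕜 B₀ B₁ V) (θ p : ℝ) (hp : 1 ≤ p) :
    Submodule 𝕜 V where
  carrier := {a | a ∈ B.sumSpace ∧ B.interpENorm θ p a < ∞}
  zero_mem' := by
    have hp0 : 0 < p := by linarith
    refine ⟨Submodule.zero_mem _, ?_⟩
    simp [interpENorm, K_zero, hp0]
  add_mem' := by
    rintro a b ⟨ha, ha'⟩ ⟨hb, hb'⟩
    refine ⟨Submodule.add_mem _ ha hb, ?_⟩
    rw [interpENorm_lt_top_iff B θ hp] at ha' hb' ⊢
    have hm : Measurable fun t : ℝ =>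
        (B.K t a / ENNReal.ofReal (t ^ θ)) ^ p / ENNReal.ofReal t := by
      have := (B.K_mono a).measurable
      fun_prop
    calc ∫⁻ t in Set.Ioi (0 : ℝ), (B.K t (a + b) / ENNReal.ofReal (t ^ θ)) ^ p / ENNReal.ofReal t
        ≤ ∫⁻ t in Set.Ioi (0 : ℝ), 2 ^ (p - 1) *
            ((B.K t a / ENNReal.ofReal (t ^ θ)) ^ p / ENNReal.ofReal t +
              (B.K t b / ENNReal.ofReal (t ^ θ)) ^ p / ENNReal.ofReal t) := by
          refine MeasureTheory.lintegral_mono fun t => ?_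
          rw [← ENNReal.add_div, ← mul_div_assoc]
          gcongr
          refine le_trans ?_ (ENNReal.rpow_add_le_mul_rpow_add_rpow _ _ hp)
          rw [← ENNReal.add_div]
          gcongr
          exact B.K_add_le t a b
      _ < ∞ := by
          rw [MeasureTheory.lintegral_const_mul' _ _ (by
            exact ENNReal.rpow_ne_top_of_nonneg (by linarith) (by simp)),
            MeasureTheory.lintegral_add_left hm]
          exact ENNReal.mul_lt_top
            (ENNReal.rpow_lt_top_of_nonneg (by linarith) (by simp))
            (ENNReal.add_lt_top.2 ⟨ha', hb'⟩)
  smul_mem' := by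
    rintro c a ⟨ha, ha'⟩
    have hp0 : 0 ≤ p := by linarith
    refine ⟨Submodule.smul_mem _ c ha, ?_⟩
    rw [interpENorm_lt_top_iff B θ hp] at ha' ⊢
    calc ∫⁻ t in Set.Ioi (0 : ℝ), (B.K t (c • a) / ENNReal.ofReal (t ^ θ)) ^ p / ENNReal.ofReal t
        ≤ ∫⁻ t in Set.Ioi (0 : ℝ), ‖c‖ₑ ^ p *
            ((B.K t a / ENNReal.ofReal (t ^ θ)) ^ p / ENNReal.ofReal t) := by
          refine MeasureTheory.lintegral_mono fun t => ?_
          rw [← mul_div_assoc, ← ENNReal.mul_rpow_of_nonneg _ _ hp0, ← mul_div_assoc]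
          gcongr
          exact B.K_smul_le t c a
      _ < ∞ := by
          rw [MeasureTheory.lintegral_const_mul' _ _
            (ENNReal.rpow_ne_top_of_nonneg hp0 (by simp))]
          exact ENNReal.mul_lt_top (ENNReal.rpow_lt_top_of_nonneg hp0 (by simp)) ha'

/-- The norm `‖a‖_{θ,p} = (∫₀^∞ (K(t, a) / t ^ θ) ^ p dt / t) ^ (1 / p)` of `B_{θ,p}`. -/
noncomputable def interpNorm (B : InterpolationCouple 𝕜 B₀ B₁ V) (θ p : ℝ) (hp : 1 ≤ p)
    (a : B.realInterp θ p hp) : ℝ :=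
  (B.interpENorm θ p (a : V)).toReal

end InterpolationCouple

/-!
The equivalent norm comes from sequences of decompositions. For `a` in `B_{θ,p}` take all sequences
`(xₙ, yₙ)` in `B₀ × B₁`, `n ∈ ℤ`, with `a = xₙ + yₙ` for every `n`, and let `N(a) ^ p` be the infimum
of `∑ (2 ^ (-θn) ‖xₙ‖) ^ p + ∑ (2 ^ ((1 - θ)n) ‖yₙ‖) ^ p`. Choosing the decompositions one `n` at a
time shows that `N(a) ^ p` is comparable to `∑ (2 ^ (-θn) K(2 ^ n, a)) ^ p`, hence, as `K` is monotone
in `t`, to the integral defining the interpolation norm (`decompNorm_equiv`).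

For uniform rotundity (`exists_decompNorm_sub_rpow_le`) let `N(a) = N(b) = 1` and let `N(a + b)` be
close to `2`. Take near-optimal sequences for `a` and `b`; their midpoint represents `(a + b) / 2`, so
it is nearly as large as they are. In `B₀` the convexity defect of the `p`-th power controls the
distance (`exists_norm_sub_rpow_add_le`), and in `B₁` the defect is at least nonnegative. Hence the
`B₀`-part of the difference of the two sequences is small, while its `B₁`-part is merely bounded. But
any translate in `n` of this difference still represents `a - b`, and translation by `k` multiplies
the `B₁`-part by `2 ^ (-(1 - θ)kp)` and the `B₀`-part by `2 ^ (θkp)` (`weightedSum_shift`). Fixing `k`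
large first, both parts become small, so `N(a - b)` is small.
-/

/-! ### Uniform convexity in terms of `p`-th powers -/

theorem midpoint_rpow_add_le {E : Type*} [SeminormedAddCommGroup E] {p : ℝ} (hp : 1 ≤ p)
    (x y : E) : (‖x + y‖ / 2) ^ p ≤ (‖x‖ ^ p + ‖y‖ ^ p) / 2 := by
  have h := (convexOn_rpow hp).2 (norm_nonneg x) (norm_nonneg y)
    (by norm_num : (0 : ℝ) ≤ 1 / 2) (by norm_num : (0 : ℝ) ≤ 1 / 2) (by norm_num)
  simp only [smul_eq_mul] at h
  calc (‖x + y‖ / 2) ^ p ≤ (1 / 2 * ‖x‖ + 1 / 2 * ‖y‖) ^ p := by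
        apply Real.rpow_le_rpow (by positivity) _ (by linarith)
        linarith [norm_add_le x y]
    _ ≤ _ := by linarith

/-- Strict convexity of `s ↦ s ^ p` handles the case where `‖y‖` stays away from `‖x‖ = 1`,
uniform convexity the case where it is close to `1`. -/
theorem exists_pos_add_le_of_norm_eq_one (E : Type*) [SeminormedAddCommGroup E]
    [NormedSpace ℝ E] [UniformConvexSpace E] {p : ℝ} (hp : 1 < p) {ε : ℝ} (hε : 0 < ε) :
    ∃ c : ℝ, 0 < c ∧ ∀ x y : E, ‖x‖ = 1 → ‖y‖ ≤ 1 → ε ≤ ‖x - y‖ ^ p →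
      (‖x + y‖ / 2) ^ p + c ≤ (1 + ‖y‖ ^ p) / 2 := by
  have hp0 : 0 < p := by linarith
  obtain ⟨δ', hδ', H⟩ := exists_forall_closed_ball_dist_add_le_two_sub E
    (Real.rpow_pos_of_pos hε p⁻¹)
  obtain ⟨δ, hδ, hδ1, hδδ'⟩ : ∃ δ : ℝ, 0 < δ ∧ δ ≤ 1 ∧ δ ≤ δ' :=
    ⟨min δ' 1, by positivity, min_le_right _ _, min_le_left _ _⟩
  -- The threshold `s₀ = 1 - δ / 2` makes `‖x + y‖ / 2 ≤ s₀` under uniform convexity.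
  set s₀ : ℝ := 1 - δ / 2 with hs₀
  have hs₀0 : 0 ≤ s₀ := by linarith
  have hq : s₀ ^ p < 1 := Real.rpow_lt_one hs₀0 (by linarith) hp0
  have hcont : ContinuousOn (fun s : ℝ => (1 + s ^ p) / 2 - ((1 + s) / 2) ^ p)
      (Set.Icc 0 s₀) := by
    apply Continuous.continuousOn
    have h1 : Continuous fun s : ℝ => s ^ p := Real.continuous_rpow_const hp0.le
    have h2 : Continuous fun s : ℝ => ((1 + s) / 2) ^ p := h1.comp (by fun_prop)
    fun_prop
  obtain ⟨m, hm, hmin⟩ := isCompact_Icc.exists_isMinOn (Set.nonempty_Icc.2 hs₀0) hcont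
  have hpos : 0 < (1 + m ^ p) / 2 - ((1 + m) / 2) ^ p := by
    have h := (strictConvexOn_rpow hp).2 (x := 1) (y := m) (by simp) hm.1
      (by linarith [hm.2] : (1 : ℝ) ≠ m)
      (by norm_num : (0 : ℝ) < 1 / 2) (by norm_num : (0 : ℝ) < 1 / 2) (by norm_num)
    simp only [smul_eq_mul, Real.one_rpow] at h
    have e : (1 / 2 * 1 + 1 / 2 * m : ℝ) = (1 + m) / 2 := by ring
    rw [e] at h
    linarith
  refine ⟨min ((1 - s₀ ^ p) / 2) ((1 + m ^ p) / 2 - ((1 + m) / 2) ^ p),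
    lt_min (by linarith) hpos, fun x y hx hy hxy => ?_⟩
  rcases le_total ‖y‖ s₀ with hys | hys
  · have h1 := hmin (a := ‖y‖) ⟨norm_nonneg _, hys⟩
    simp only [Set.mem_ofPred_eq] at h1
    have h2 : (‖x + y‖ / 2) ^ p ≤ ((1 + ‖y‖) / 2) ^ p := by
      apply Real.rpow_le_rpow (by positivity) _ hp0.le
      linarith [norm_add_le x y]
    linarith [min_le_right ((1 - s₀ ^ p) / 2) ((1 + m ^ p) / 2 - ((1 + m) / 2) ^ p)]
  · have h1 : ‖x + y‖ ≤ 2 - δ' := by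
      refine H hx.le hy ?_
      rw [Real.rpow_inv_le_iff_of_pos hε.le (norm_nonneg _) hp0]
      exact hxy
    have h2 : (‖x + y‖ / 2) ^ p ≤ s₀ ^ p :=
      Real.rpow_le_rpow (by positivity) (by linarith) hp0.le
    have h3 : s₀ ^ p ≤ ‖y‖ ^ p := Real.rpow_le_rpow hs₀0 hys hp0.le
    linarith [min_le_left ((1 - s₀ ^ p) / 2) ((1 + m ^ p) / 2 - ((1 + m) / 2) ^ p)]

/-- Homogeneous form of uniform convexity: up to `ε`, the distance `‖x - y‖ ^ p` is controlled
by the defect `(‖x‖ ^ p + ‖y‖ ^ p) / 2 - ‖(x + y) / 2‖ ^ p`. Being linear in the `p`-th powers,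
it can be summed over the terms of two sequences. -/
theorem exists_norm_sub_rpow_add_le (E : Type*) [SeminormedAddCommGroup E] [NormedSpace ℝ E]
    [UniformConvexSpace E] {p : ℝ} (hp : 1 < p) {ε : ℝ} (hε : 0 < ε) :
    ∃ C : ℝ, 0 ≤ C ∧ ∀ x y : E,
      ‖x - y‖ ^ p + C * (‖x + y‖ / 2) ^ p ≤ (ε + C / 2) * (‖x‖ ^ p + ‖y‖ ^ p) := by
  have hp0 : 0 < p := by linarith
  obtain ⟨c, hc, H⟩ := exists_pos_add_le_of_norm_eq_one E hp hε
  have hC : 0 < 2 ^ p / c := by positivity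
  have key : ∀ x y : E, ‖x‖ = 1 → ‖y‖ ≤ 1 → ‖x - y‖ ^ p + 2 ^ p / c * (‖x + y‖ / 2) ^ p
      ≤ (ε + 2 ^ p / c / 2) * (1 + ‖y‖ ^ p) := by
    intro x y hx hy
    have hy0 : 0 ≤ ‖y‖ ^ p := by positivity
    rcases lt_or_ge (‖x - y‖ ^ p) ε with h | h
    · have h1 := midpoint_rpow_add_le hp.le x y
      rw [hx, Real.one_rpow] at h1
      have h2 := mul_le_mul_of_nonneg_left h1 hC.le
      nlinarith [mul_nonneg hε.le hy0]
    · have h1 := mul_le_mul_of_nonneg_left (H x y hx hy h) hC.le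
      have h2 : ‖x - y‖ ^ p ≤ 2 ^ p :=
        Real.rpow_le_rpow (norm_nonneg _) (by linarith [norm_sub_le x y]) hp0.le
      have h3 : 2 ^ p / c * c = 2 ^ p := by field_simp
      nlinarith [mul_nonneg hε.le hy0]
  have key2 : ∀ x y : E, ‖y‖ ≤ ‖x‖ → ‖x - y‖ ^ p + 2 ^ p / c * (‖x + y‖ / 2) ^ p
      ≤ (ε + 2 ^ p / c / 2) * (‖x‖ ^ p + ‖y‖ ^ p) := by
    intro x y hyx
    rcases (norm_nonneg x).eq_or_lt with hx | hx
    · have hy : ‖y‖ = 0 := le_antisymm (hx ▸ hyx) (norm_nonneg _)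
      have h1 : ‖x - y‖ = 0 := le_antisymm ((norm_sub_le x y).trans (by simp [← hx, hy]))
        (norm_nonneg _)
      have h2 : ‖x + y‖ = 0 := le_antisymm ((norm_add_le x y).trans (by simp [← hx, hy]))
        (norm_nonneg _)
      simp [h1, h2, ← hx, hy, Real.zero_rpow hp0.ne']
    · set r := ‖x‖ with hr
      have hn : ∀ z : E, ‖r⁻¹ • z‖ = r⁻¹ * ‖z‖ := fun z => by
        rw [norm_smul, Real.norm_of_nonneg (by positivity)]
      have h := key (r⁻¹ • x) (r⁻¹ • y) (by rw [hn, ← hr]; field_simp)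
        (by rw [hn]; field_simp; exact hyx)
      rw [← smul_sub, ← smul_add, hn, hn, hn, mul_div_assoc,
        Real.mul_rpow (by positivity) (norm_nonneg _), Real.mul_rpow (by positivity)
        (by positivity), Real.mul_rpow (by positivity) (by positivity), Real.inv_rpow hx.le] at h
      have hrp : 0 < r ^ p := Real.rpow_pos_of_pos hx p
      have h' := mul_le_mul_of_nonneg_left h hrp.le
      field_simp at h' ⊢
      linarith
  refine ⟨2 ^ p / c, hC.le, fun x y => ?_⟩
  rcases le_total ‖y‖ ‖x‖ with h | h
  · exact key2 x y h
  · rw [norm_sub_rev, add_comm x y, add_comm (‖x‖ ^ p)]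
    exact key2 y x h

/-! ### Weighted sums of `p`-th powers of norms over `ℤ` -/

/-- The `p`-th power of the norm of `u` in the weighted space `ℓ^p(ℤ; E)` with weights
`2 ^ (s * n)`, possibly infinite. -/
noncomputable def weightedSum {E : Type*} [ENorm E] (p s : ℝ) (u : ℤ → E) : ℝ≥0∞ :=
  ∑' n : ℤ, (ENNReal.ofReal ((2 : ℝ) ^ (s * n)) * ‖u n‖ₑ) ^ p

section weightedSum

variable {𝕜 E : Type*} [RCLike 𝕜] [NormedAddCommGroup E] [NormedSpace 𝕜 E] {p : ℝ}

theorem weightedSum_smul (hp : 0 ≤ p) (s : ℝ) (c : 𝕜) (u : ℤ → E) :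
    weightedSum p s (c • u) = ‖c‖ₑ ^ p * weightedSum p s u := by
  simp only [weightedSum, ← ENNReal.tsum_mul_left, Pi.smul_apply, enorm_smul]
  refine tsum_congr fun n => ?_
  rw [← ENNReal.mul_rpow_of_nonneg _ _ hp]
  ring_nf

theorem weightedSum_convex (hp : 1 ≤ p) (s : ℝ) {c d : 𝕜} (hcd : ‖c‖ₑ + ‖d‖ₑ = 1)
    (u v : ℤ → E) :
    weightedSum p s (c • u + d • v) ≤ ‖c‖ₑ * weightedSum p s u + ‖d‖ₑ * weightedSum p s v := by
  simp only [weightedSum, ← ENNReal.tsum_mul_left]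
  rw [← ENNReal.tsum_add]
  refine ENNReal.tsum_le_tsum fun n => ?_
  refine le_trans ?_ (ENNReal.rpow_arith_mean_le_arith_mean2_rpow _ _ _ _ hcd hp)
  gcongr
  calc ENNReal.ofReal ((2 : ℝ) ^ (s * n)) * ‖(c • u + d • v) n‖ₑ
      ≤ ENNReal.ofReal ((2 : ℝ) ^ (s * n)) * (‖c‖ₑ * ‖u n‖ₑ + ‖d‖ₑ * ‖v n‖ₑ) := by
        gcongr
        refine (enorm_add_le _ _).trans ?_
        simp [enorm_smul]
    _ = _ := by ring

theorem weightedSum_sub_le (hp : 1 ≤ p) (s : ℝ) (u v : ℤ → E) :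
    weightedSum p s (u - v) ≤ 2 ^ (p - 1) * (weightedSum p s u + weightedSum p s v) := by
  simp only [weightedSum]
  rw [← ENNReal.tsum_add, ← ENNReal.tsum_mul_left]
  refine ENNReal.tsum_le_tsum fun n => ?_
  refine le_trans ?_ (ENNReal.rpow_add_le_mul_rpow_add_rpow _ _ hp)
  rw [← mul_add]
  gcongr
  exact enorm_sub_le

/-- Translating the index multiplies the weighted sum by a factor; it is small or large
according to the signs of `s` and `k`. -/
theorem weightedSum_shift (hp : 0 ≤ p) (s : ℝ) (k : ℤ) (u : ℤ → E) :
    weightedSum p s (fun n => u (n + k)) =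
      ENNReal.ofReal ((2 : ℝ) ^ (-s * k)) ^ p * weightedSum p s u := by
  simp only [weightedSum]
  rw [← (Equiv.addRight k).tsum_eq (fun n : ℤ =>
    (ENNReal.ofReal ((2 : ℝ) ^ (s * n)) * ‖u n‖ₑ) ^ p), ← ENNReal.tsum_mul_left]
  refine tsum_congr fun n => ?_
  rw [← ENNReal.mul_rpow_of_nonneg _ _ hp, ← mul_assoc,
    ← ENNReal.ofReal_mul (by positivity), ← Real.rpow_add two_pos]
  congr 5
  simp only [Equiv.coe_addRight]
  push_cast
  ring

/-- Uniform convexity of `E` passes to the weighted `ℓ^p` space: `exists_norm_sub_rpow_add_le` summed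
over the index, with a constant independent of the weights. -/
theorem exists_weightedSum_sub_add_le [UniformConvexSpace E] (hp : 1 < p) {ε : ℝ}
    (hε : 0 < ε) : ∃ C : ℝ, 0 ≤ C ∧ ∀ (s : ℝ) (u v : ℤ → E),
      weightedSum p s (u - v) + ENNReal.ofReal C * weightedSum p s ((2⁻¹ : 𝕜) • (u + v)) ≤
        ENNReal.ofReal (ε + C / 2) * (weightedSum p s u + weightedSum p s v) := by
  have hp0 : 0 ≤ p := by linarith
  let _ : NormedSpace ℝ E := NormedSpace.restrictScalars ℝ 𝕜 E
  obtain ⟨C, hC, H⟩ := exists_norm_sub_rpow_add_le E hp hε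
  refine ⟨C, hC, fun s u v => ?_⟩
  simp only [weightedSum, ← ENNReal.tsum_mul_left, ← ENNReal.tsum_add]
  refine ENNReal.tsum_le_tsum fun n => ?_
  have e : ∀ x : E, ‖x‖ₑ ^ p = ENNReal.ofReal (‖x‖ ^ p) := fun x => by
    rw [← ofReal_norm, ENNReal.ofReal_rpow_of_nonneg (norm_nonneg _) hp0]
  have h : ‖(u - v) n‖ₑ ^ p + ENNReal.ofReal C * ‖((2⁻¹ : 𝕜) • (u + v)) n‖ₑ ^ p ≤
      ENNReal.ofReal (ε + C / 2) * (‖u n‖ₑ ^ p + ‖v n‖ₑ ^ p) := by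
    rw [e, e, e, e, ← ENNReal.ofReal_mul hC, ← ENNReal.ofReal_add (by positivity) (by positivity),
      ← ENNReal.ofReal_add (by positivity) (by positivity), ← ENNReal.ofReal_mul (by positivity)]
    apply ENNReal.ofReal_le_ofReal
    have h2 : ‖((2⁻¹ : 𝕜) • (u + v)) n‖ = ‖u n + v n‖ / 2 := by
      rw [Pi.smul_apply, norm_smul, norm_inv, RCLike.norm_two, Pi.add_apply]
      ring
    rw [h2]
    exact H (u n) (v n)
  simp only [ENNReal.mul_rpow_of_nonneg _ _ hp0]
  calc _ = ENNReal.ofReal ((2 : ℝ) ^ (s * n)) ^ p * (‖(u - v) n‖ₑ ^ p +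
        ENNReal.ofReal C * ‖((2⁻¹ : 𝕜) • (u + v)) n‖ₑ ^ p) := by ring
    _ ≤ ENNReal.ofReal ((2 : ℝ) ^ (s * n)) ^ p *
        (ENNReal.ofReal (ε + C / 2) * (‖u n‖ₑ ^ p + ‖v n‖ₑ ^ p)) := by gcongr
    _ = _ := by ring

end weightedSum

namespace InterpolationCouple

variable {𝕜 B₀ B₁ V : Type*} [RCLike 𝕜]
  [NormedAddCommGroup B₀] [NormedSpace 𝕜 B₀] [NormedAddCommGroup B₁] [NormedSpace 𝕜 B₁]
  [AddCommGroup V] [Module 𝕜 V] [TopologicalSpace V]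

/-! ### The dyadic form of the interpolation norm -/

theorem iUnion_Ioc_two_zpow : ⋃ n : ℤ, Set.Ioc ((2 : ℝ) ^ n) (2 ^ (n + 1)) = Set.Ioi 0 := by
  ext t
  simp only [Set.mem_iUnion, Set.mem_Ioi]
  constructor
  · rintro ⟨n, hn⟩
    exact lt_trans (by positivity) hn.1
  · exact fun ht => exists_mem_Ioc_zpow ht one_lt_two

theorem pairwise_disjoint_Ioc_two_zpow :
    Pairwise (Function.onFun Disjoint fun n : ℤ => Set.Ioc ((2 : ℝ) ^ n) (2 ^ (n + 1))) := by
  have h : Monotone fun n : ℤ => (2 : ℝ) ^ n := zpow_right_mono₀ one_le_two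
  simpa using h.pairwise_disjoint_on_Ioc_succ

/-- The dyadic sum `∑ n, (2 ^ (-θ n) K(2 ^ n, a)) ^ p`. -/
noncomputable def dyadicSum (B : InterpolationCouple 𝕜 B₀ B₁ V) (θ p : ℝ) (a : V) : ℝ≥0∞ :=
  ∑' n : ℤ, (ENNReal.ofReal ((2 : ℝ) ^ (-θ * n)) * B.K (2 ^ n) a) ^ p

theorem div_ofReal_zpow_rpow (θ : ℝ) (n : ℤ) (x : ℝ≥0∞) :
    x / ENNReal.ofReal (((2 : ℝ) ^ n) ^ θ) = ENNReal.ofReal ((2 : ℝ) ^ (-θ * n)) * x := by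
  rw [ENNReal.div_eq_inv_mul, ← ENNReal.ofReal_inv_of_pos (by positivity), ← Real.rpow_intCast,
    ← Real.rpow_mul two_pos.le, ← Real.rpow_neg two_pos.le]
  congr 3
  ring

theorem lintegral_K_eq_tsum (B : InterpolationCouple 𝕜 B₀ B₁ V) (θ p : ℝ) (a : V) :
    ∫⁻ t in Set.Ioi (0 : ℝ), (B.K t a / ENNReal.ofReal (t ^ θ)) ^ p / ENNReal.ofReal t =
      ∑' n : ℤ, ∫⁻ t in Set.Ioc ((2 : ℝ) ^ n) (2 ^ (n + 1)),
        (B.K t a / ENNReal.ofReal (t ^ θ)) ^ p / ENNReal.ofReal t := by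
  rw [← iUnion_Ioc_two_zpow, MeasureTheory.lintegral_iUnion (fun _ => measurableSet_Ioc)
    pairwise_disjoint_Ioc_two_zpow]

theorem volume_Ioc_two_zpow (n : ℤ) :
    MeasureTheory.volume (Set.Ioc ((2 : ℝ) ^ n) (2 ^ (n + 1))) = ENNReal.ofReal (2 ^ n) := by
  rw [Real.volume_Ioc, zpow_add_one₀ two_ne_zero]
  congr 1
  ring

theorem ofReal_two_zpow_succ (n : ℤ) :
    ENNReal.ofReal ((2 : ℝ) ^ (n + 1)) = 2 * ENNReal.ofReal (2 ^ n) := by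
  rw [zpow_add_one₀ two_ne_zero, mul_comm, ENNReal.ofReal_mul two_pos.le]
  simp

theorem ofReal_two_rpow_mul_succ (θ : ℝ) (n : ℤ) :
    ENNReal.ofReal ((2 : ℝ) ^ (-θ * n)) =
      ENNReal.ofReal (2 ^ θ) * ENNReal.ofReal ((2 : ℝ) ^ (-θ * ((n + 1 : ℤ) : ℝ))) := by
  rw [← ENNReal.ofReal_mul (by positivity), ← Real.rpow_add two_pos]
  congr 2
  push_cast
  ring

theorem lintegral_K_le_dyadicSum (B : InterpolationCouple 𝕜 B₀ B₁ V) {θ p : ℝ} (hθ : 0 ≤ θ)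
    (hp : 0 ≤ p) (a : V) :
    ∫⁻ t in Set.Ioi (0 : ℝ), (B.K t a / ENNReal.ofReal (t ^ θ)) ^ p / ENNReal.ofReal t ≤
      ENNReal.ofReal (2 ^ θ) ^ p * B.dyadicSum θ p a := by
  rw [lintegral_K_eq_tsum, dyadicSum, ← (Equiv.addRight (1 : ℤ)).tsum_eq (fun n : ℤ =>
    (ENNReal.ofReal ((2 : ℝ) ^ (-θ * n)) * B.K (2 ^ n) a) ^ p), ← ENNReal.tsum_mul_left]
  refine ENNReal.tsum_le_tsum fun n => ?_
  have h2n : (0 : ℝ) < 2 ^ n := by positivity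
  calc ∫⁻ t in Set.Ioc ((2 : ℝ) ^ n) (2 ^ (n + 1)),
        (B.K t a / ENNReal.ofReal (t ^ θ)) ^ p / ENNReal.ofReal t
      ≤ ∫⁻ _ in Set.Ioc ((2 : ℝ) ^ n) (2 ^ (n + 1)),
        (B.K (2 ^ (n + 1)) a / ENNReal.ofReal (((2 : ℝ) ^ n) ^ θ)) ^ p /
          ENNReal.ofReal (2 ^ n) := by
        refine MeasureTheory.setLIntegral_mono' measurableSet_Ioc fun t ht => ?_
        have h := B.K_mono a ht.2
        simp only at h
        have h' := ht.1.le
        gcongr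
    _ = (ENNReal.ofReal ((2 : ℝ) ^ (-θ * n)) * B.K (2 ^ (n + 1)) a) ^ p := by
        rw [MeasureTheory.setLIntegral_const, volume_Ioc_two_zpow, div_ofReal_zpow_rpow,
          ENNReal.div_mul_cancel (by simpa using h2n) ENNReal.ofReal_ne_top]
    _ ≤ _ := by
        rw [← ENNReal.mul_rpow_of_nonneg _ _ hp, ofReal_two_rpow_mul_succ, mul_assoc]
        rfl

theorem dyadicSum_le_lintegral_K (B : InterpolationCouple 𝕜 B₀ B₁ V) {θ p : ℝ} (hθ : 0 ≤ θ)
    (hp : 0 ≤ p) (a : V) :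
    B.dyadicSum θ p a ≤ 2 * ENNReal.ofReal (2 ^ θ) ^ p *
      ∫⁻ t in Set.Ioi (0 : ℝ), (B.K t a / ENNReal.ofReal (t ^ θ)) ^ p / ENNReal.ofReal t := by
  rw [lintegral_K_eq_tsum, dyadicSum, ← ENNReal.tsum_mul_left]
  refine ENNReal.tsum_le_tsum fun n => ?_
  have h2n : (0 : ℝ) < 2 ^ n := by positivity
  calc (ENNReal.ofReal ((2 : ℝ) ^ (-θ * n)) * B.K (2 ^ n) a) ^ p
      = 2 * ENNReal.ofReal (2 ^ θ) ^ p * ∫⁻ _ in Set.Ioc ((2 : ℝ) ^ n) (2 ^ (n + 1)),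
        (B.K (2 ^ n) a / ENNReal.ofReal (((2 : ℝ) ^ (n + 1)) ^ θ)) ^ p /
          ENNReal.ofReal (2 ^ (n + 1)) := by
        have hne : ENNReal.ofReal ((2 : ℝ) ^ n) ≠ 0 := by simpa using h2n
        rw [MeasureTheory.setLIntegral_const, volume_Ioc_two_zpow, div_ofReal_zpow_rpow,
          ofReal_two_rpow_mul_succ, mul_assoc, ENNReal.mul_rpow_of_nonneg _ _ hp,
          ofReal_two_zpow_succ]
        generalize (ENNReal.ofReal ((2 : ℝ) ^ (-θ * ((n + 1 : ℤ) : ℝ))) * B.K (2 ^ n) a) ^ p = X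
        calc ENNReal.ofReal (2 ^ θ) ^ p * X
            = ENNReal.ofReal (2 ^ θ) ^ p * (X / (2 * ENNReal.ofReal (2 ^ n)) *
                (2 * ENNReal.ofReal (2 ^ n))) := by
              rw [ENNReal.div_mul_cancel (mul_ne_zero two_ne_zero hne)
                (ENNReal.mul_ne_top ENNReal.ofNat_ne_top ENNReal.ofReal_ne_top)]
          _ = _ := by ring
    _ ≤ _ := by
        gcongr 2 * ENNReal.ofReal (2 ^ θ) ^ p * ?_
        refine MeasureTheory.setLIntegral_mono' measurableSet_Ioc fun t ht => ?_
        have h := B.K_mono a ht.1.le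
        simp only at h
        have h' := ht.2
        have ht0 : 0 ≤ t := h2n.le.trans ht.1.le
        gcongr

/-! ### Sequences of decompositions -/

/-- `u` is a sequence of decompositions of `a`: `a = (u n).1 + (u n).2` for every `n`. -/
def IsDecomp (B : InterpolationCouple 𝕜 B₀ B₁ V) (u : ℤ → B₀ × B₁) (a : V) : Prop :=
  ∀ n, B.incl₀ (u n).1 + B.incl₁ (u n).2 = a

/-- The `p`-th power of the norm of a sequence of pairs in `ℓ^p(2 ^ (-θ n); B₀) ⊕ₚ
ℓ^p(2 ^ ((1 - θ) n); B₁)`. -/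
noncomputable def pairSum (θ p : ℝ) (u : ℤ → B₀ × B₁) : ℝ≥0∞ :=
  weightedSum p (-θ) (fun n => (u n).1) + weightedSum p (1 - θ) (fun n => (u n).2)

/-- The `p`-th power of the new norm of `a`: the infimum of `pairSum θ p u` over all sequences
`u` of decompositions of `a`. -/
noncomputable def decompInf (B : InterpolationCouple 𝕜 B₀ B₁ V) (θ p : ℝ) (a : V) : ℝ≥0∞ :=
  ⨅ (u : ℤ → B₀ × B₁) (_ : B.IsDecomp u a), pairSum θ p u

variable {B : InterpolationCouple 𝕜 B₀ B₁ V} {u v : ℤ → B₀ × B₁} {a b : V} {θ p : ℝ}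

theorem IsDecomp.add (hu : B.IsDecomp u a) (hv : B.IsDecomp v b) : B.IsDecomp (u + v) (a + b) := by
  intro n
  rw [← hu n, ← hv n]
  simp only [Pi.add_apply, Prod.fst_add, Prod.snd_add, map_add]
  abel

theorem IsDecomp.sub (hu : B.IsDecomp u a) (hv : B.IsDecomp v b) : B.IsDecomp (u - v) (a - b) := by
  intro n
  rw [← hu n, ← hv n]
  simp only [Pi.sub_apply, Prod.fst_sub, Prod.snd_sub, map_sub]
  abel

theorem IsDecomp.smul (c : 𝕜) (hu : B.IsDecomp u a) : B.IsDecomp (c • u) (c • a) := by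
  intro n
  rw [← hu n]
  simp

theorem IsDecomp.shift (k : ℤ) (hu : B.IsDecomp u a) : B.IsDecomp (fun n => u (n + k)) a :=
  fun n => hu (n + k)

theorem decompInf_le (hu : B.IsDecomp u a) : B.decompInf θ p a ≤ pairSum θ p u :=
  iInf₂_le u hu

theorem exists_isDecomp_lt {r : ℝ≥0∞} (h : B.decompInf θ p a < r) :
    ∃ u, B.IsDecomp u a ∧ pairSum θ p u < r := by
  simpa [decompInf, iInf_lt_iff] using h

theorem pairSum_smul (hp : 0 ≤ p) (c : 𝕜) (u : ℤ → B₀ × B₁) :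
    pairSum θ p (c • u) = ‖c‖ₑ ^ p * pairSum θ p u := by
  rw [pairSum, pairSum, mul_add, ← weightedSum_smul hp, ← weightedSum_smul hp]
  rfl

theorem pairSum_convex (hp : 1 ≤ p) {c d : 𝕜} (hcd : ‖c‖ₑ + ‖d‖ₑ = 1) (u v : ℤ → B₀ × B₁) :
    pairSum θ p (c • u + d • v) ≤ ‖c‖ₑ * pairSum θ p u + ‖d‖ₑ * pairSum θ p v := by
  calc pairSum θ p (c • u + d • v)
      ≤ _ := add_le_add (weightedSum_convex hp (-θ) hcd (fun n => (u n).1) fun n => (v n).1)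
        (weightedSum_convex hp (1 - θ) hcd (fun n => (u n).2) fun n => (v n).2)
    _ = _ := by
      simp only [pairSum]
      ring

theorem decompInf_smul_le (B : InterpolationCouple 𝕜 B₀ B₁ V) (hp : 0 < p) (c : 𝕜) (a : V) :
    B.decompInf θ p (c • a) ≤ ‖c‖ₑ ^ p * B.decompInf θ p a := by
  rcases eq_or_ne c 0 with rfl | hc
  · have h : B.IsDecomp 0 ((0 : 𝕜) • a) := fun n => by simp
    refine (decompInf_le h).trans ?_
    simp [pairSum, weightedSum, hp]
  · have hc0 : ‖c‖ₑ ^ p ≠ 0 := by simp [hc, ENNReal.rpow_eq_zero_iff]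
    rw [decompInf, decompInf, ENNReal.mul_iInf_of_ne hc0
      (ENNReal.rpow_ne_top_of_nonneg hp.le enorm_ne_top)]
    refine le_iInf fun u => ?_
    rw [ENNReal.mul_iInf_of_ne hc0 (ENNReal.rpow_ne_top_of_nonneg hp.le enorm_ne_top)]
    refine le_iInf fun hu => ?_
    rw [← pairSum_smul hp.le]
    exact decompInf_le (hu.smul c)

theorem decompInf_convex (B : InterpolationCouple 𝕜 B₀ B₁ V) (hp : 1 ≤ p) {c d : 𝕜}
    (hcd : ‖c‖ₑ + ‖d‖ₑ = 1) {r : ℝ≥0∞} (ha : B.decompInf θ p a < r) (hb : B.decompInf θ p b < r) :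
    B.decompInf θ p (c • a + d • b) ≤ r := by
  obtain ⟨u, hu, hur⟩ := exists_isDecomp_lt ha
  obtain ⟨v, hv, hvr⟩ := exists_isDecomp_lt hb
  calc B.decompInf θ p (c • a + d • b) ≤ pairSum θ p (c • u + d • v) :=
        decompInf_le ((hu.smul c).add (hv.smul d))
    _ ≤ ‖c‖ₑ * pairSum θ p u + ‖d‖ₑ * pairSum θ p v := pairSum_convex hp hcd u v
    _ ≤ ‖c‖ₑ * r + ‖d‖ₑ * r := by gcongr
    _ = r := by rw [← add_mul, hcd, one_mul]

theorem ofReal_two_rpow_one_sub_mul (θ : ℝ) (n : ℤ) :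
    ENNReal.ofReal ((2 : ℝ) ^ ((1 - θ) * n)) =
      ENNReal.ofReal ((2 : ℝ) ^ (-θ * n)) * ENNReal.ofReal (2 ^ n) := by
  rw [← ENNReal.ofReal_mul (by positivity), ← Real.rpow_intCast, ← Real.rpow_add two_pos]
  congr 2
  ring

theorem dyadicSum_le_decompInf (B : InterpolationCouple 𝕜 B₀ B₁ V) (θ : ℝ) (hp : 1 ≤ p) (a : V) :
    B.dyadicSum θ p a ≤ 2 ^ (p - 1) * B.decompInf θ p a := by
  have h2 : (2 : ℝ≥0∞) ^ (p - 1) ≠ ∞ := ENNReal.rpow_ne_top_of_nonneg (by linarith) (by simp)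
  have h2' : (2 : ℝ≥0∞) ^ (p - 1) ≠ 0 := by simp [ENNReal.rpow_eq_zero_iff]
  simp only [decompInf, ENNReal.mul_iInf_of_ne h2' h2]
  refine le_iInf₂ fun u hu => ?_
  rw [pairSum, weightedSum, weightedSum, ← ENNReal.tsum_add, ← ENNReal.tsum_mul_left, dyadicSum]
  refine ENNReal.tsum_le_tsum fun n => ?_
  refine le_trans ?_ (ENNReal.rpow_add_le_mul_rpow_add_rpow _ _ hp)
  rw [ofReal_two_rpow_one_sub_mul, mul_assoc, ← mul_add]
  gcongr
  exact iInf₂_le (u n) (hu n)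

theorem K_lt_top (hB : a ∈ B.sumSpace) (t : ℝ) : B.K t a < ∞ := by
  obtain ⟨_, ⟨x, rfl⟩, _, ⟨y, rfl⟩, rfl⟩ := Submodule.mem_sup.1 hB
  have h : B.K t (B.incl₀ x + B.incl₁ y) ≤ ‖x‖ₑ + ENNReal.ofReal t * ‖y‖ₑ :=
    iInf₂_le (x, y) (by rfl)
  refine h.trans_lt ?_
  finiteness

/-- `K(t, a) = 0` gives `xₖ → 0` in `B₀` and `yₖ → 0` in `B₁` with `xₖ + yₖ = a`; the inclusions are
continuous and `V` is Hausdorff, so `a = 0`. -/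
theorem eq_zero_of_K_eq_zero [ContinuousAdd V] [T2Space V] {t : ℝ} (ht : 0 < t)
    (h : B.K t a = 0) : a = 0 := by
  have hx : ∀ k : ℕ, ∃ x : B₀ × B₁, B.incl₀ x.1 + B.incl₁ x.2 = a ∧
      ‖x.1‖ₑ + ENNReal.ofReal t * ‖x.2‖ₑ < ENNReal.ofReal (1 / ((k : ℝ) + 1)) := fun k => by
    have hk : B.K t a < ENNReal.ofReal (1 / ((k : ℝ) + 1)) := by
      rw [h, ENNReal.ofReal_pos]
      positivity
    simpa only [K, iInf_lt_iff, exists_prop] using hk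
  choose x hxa hx using hx
  have hlim : Filter.Tendsto (fun k : ℕ => ENNReal.ofReal (1 / ((k : ℝ) + 1)))
      Filter.atTop (nhds 0) := by
    simpa using ENNReal.tendsto_ofReal (tendsto_one_div_add_atTop_nhds_zero_nat (𝕜 := ℝ))
  have h0 : Filter.Tendsto (fun k => (x k).1) Filter.atTop (nhds 0) := by
    rw [tendsto_zero_iff_enorm_tendsto_zero]
    exact tendsto_of_tendsto_of_tendsto_of_le_of_le tendsto_const_nhds hlim (fun _ => zero_le)
      fun k => le_self_add.trans (hx k).le
  have h1 : Filter.Tendsto (fun k => (x k).2) Filter.atTop (nhds 0) := by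
    rw [tendsto_zero_iff_enorm_tendsto_zero]
    have ht0 : ENNReal.ofReal t ≠ 0 := by simpa using ht
    have hlim' := ENNReal.Tendsto.div_const hlim (Or.inr ht0)
    rw [ENNReal.zero_div] at hlim'
    refine tendsto_of_tendsto_of_tendsto_of_le_of_le tendsto_const_nhds hlim' (fun _ => zero_le)
      fun k => ?_
    rw [ENNReal.le_div_iff_mul_le (Or.inl ht0) (Or.inl ENNReal.ofReal_ne_top), mul_comm]
    exact le_add_self.trans (hx k).le
  have hsum := ((B.incl₀.continuous.tendsto 0).comp h0).add
    ((B.incl₁.continuous.tendsto 0).comp h1)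
  simp only [map_zero, add_zero] at hsum
  refine tendsto_nhds_unique (tendsto_const_nhds.congr fun k => ?_) hsum
  exact (hxa k).symm

theorem decompInf_le_dyadicSum [ContinuousAdd V] [T2Space V] (hp : 1 ≤ p)
    (ha : a ∈ B.sumSpace) : B.decompInf θ p a ≤ 2 ^ p * B.dyadicSum θ p a := by
  have hp0 : 0 < p := by linarith
  rcases eq_or_ne a 0 with rfl | ha0
  · refine ((zero_smul 𝕜 (0 : V)) ▸ B.decompInf_smul_le (θ := θ) hp0 (0 : 𝕜) 0).trans ?_
    simp [hp0]
  -- `0 < K(2 ^ n, a) < ∞`, so there are decompositions within a factor `2` of the infimum.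
  have hx : ∀ n : ℤ, ∃ x : B₀ × B₁, B.incl₀ x.1 + B.incl₁ x.2 = a ∧
      ‖x.1‖ₑ + ENNReal.ofReal (2 ^ n) * ‖x.2‖ₑ < 2 * B.K (2 ^ n) a := fun n => by
    have h0 : B.K (2 ^ n) a ≠ 0 := fun h => ha0 (eq_zero_of_K_eq_zero (by positivity) h)
    have hk : B.K (2 ^ n) a < 2 * B.K (2 ^ n) a := by
      rw [two_mul]
      exact ENNReal.lt_add_right (K_lt_top ha _).ne h0
    conv at hk => lhs; unfold K
    simpa only [iInf_lt_iff, exists_prop] using hk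
  choose u hu hu' using hx
  refine (decompInf_le hu).trans ?_
  rw [pairSum, weightedSum, weightedSum, ← ENNReal.tsum_add, dyadicSum, ← ENNReal.tsum_mul_left]
  refine ENNReal.tsum_le_tsum fun n => ?_
  refine (ENNReal.add_rpow_le_rpow_add _ _ hp).trans ?_
  rw [← ENNReal.mul_rpow_of_nonneg _ _ hp0.le]
  gcongr
  rw [ofReal_two_rpow_one_sub_mul, mul_assoc, ← mul_add, mul_left_comm]
  gcongr
  exact (hu' n).le

/-! ### The new norm -/

/-- The candidate for the uniformly rotund norm, `decompInf ^ (1 / p)`. -/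
noncomputable def decompNorm (B : InterpolationCouple 𝕜 B₀ B₁ V) (θ p : ℝ) (a : V) : ℝ :=
  (B.decompInf θ p a).toReal ^ (1 / p)

theorem decompNorm_nonneg (B : InterpolationCouple 𝕜 B₀ B₁ V) (θ p : ℝ) (a : V) :
    0 ≤ B.decompNorm θ p a := by
  unfold decompNorm
  positivity

theorem decompNorm_rpow (B : InterpolationCouple 𝕜 B₀ B₁ V) (θ : ℝ) (hp : 0 < p) (a : V) :
    B.decompNorm θ p a ^ p = (B.decompInf θ p a).toReal := by
  rw [decompNorm, ← Real.rpow_mul ENNReal.toReal_nonneg, one_div, inv_mul_cancel₀ hp.ne',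
    Real.rpow_one]

theorem decompInf_eq_ofReal (hp : 0 < p) (ha : B.decompInf θ p a ≠ ∞) :
    B.decompInf θ p a = ENNReal.ofReal (B.decompNorm θ p a ^ p) := by
  rw [decompNorm_rpow B θ hp, ENNReal.ofReal_toReal ha]

theorem decompNorm_le_of_decompInf_le (hp : 0 < p) {r : ℝ} (hr : 0 ≤ r)
    (h : B.decompInf θ p a ≤ ENNReal.ofReal (r ^ p)) : B.decompNorm θ p a ≤ r := by
  have h1 : (B.decompInf θ p a).toReal ≤ r ^ p :=
    ENNReal.toReal_le_of_le_ofReal (by positivity) h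
  rw [← decompNorm_rpow B θ hp] at h1
  exact (Real.rpow_le_rpow_iff (decompNorm_nonneg B θ p a) hr hp).1 h1

theorem decompInf_ne_top [ContinuousAdd V] [T2Space V] (hθ : 0 ≤ θ) (hp : 1 ≤ p)
    (ha : a ∈ B.realInterp θ p hp) : B.decompInf θ p a ≠ ∞ := by
  have hp0 : 0 < p := by linarith
  have h := (interpENorm_lt_top_iff B θ hp a).1 ha.2
  refine ne_top_of_le_ne_top ?_ (decompInf_le_dyadicSum hp ha.1)
  refine ENNReal.mul_ne_top (ENNReal.rpow_ne_top_of_nonneg hp0.le (by simp)) ?_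
  refine ne_top_of_le_ne_top ?_ (dyadicSum_le_lintegral_K B hθ hp0.le a)
  exact ENNReal.mul_ne_top (ENNReal.mul_ne_top (by simp)
    (ENNReal.rpow_ne_top_of_nonneg hp0.le (by simp))) h.ne

theorem decompNorm_smul_le (hp : 0 < p) (ha : B.decompInf θ p a ≠ ∞) (c : 𝕜) :
    B.decompNorm θ p (c • a) ≤ ‖c‖ * B.decompNorm θ p a := by
  have hN := decompNorm_nonneg B θ p a
  refine decompNorm_le_of_decompInf_le hp (by positivity) ?_
  refine (decompInf_smul_le B hp c a).trans ?_
  rw [decompInf_eq_ofReal hp ha, Real.mul_rpow (norm_nonneg _) hN,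
    ENNReal.ofReal_mul (by positivity), ← ofReal_norm,
    ENNReal.ofReal_rpow_of_nonneg (norm_nonneg _) hp.le]

theorem decompNorm_smul (hp : 0 < p) (c : 𝕜)
    (h : ∀ d : 𝕜, B.decompInf θ p (d • a) ≠ ∞) :
    B.decompNorm θ p (c • a) = ‖c‖ * B.decompNorm θ p a := by
  have ha : B.decompInf θ p a ≠ ∞ := by simpa using h 1
  refine le_antisymm (decompNorm_smul_le hp ha c) ?_
  rcases eq_or_ne c 0 with rfl | hc
  · simpa using decompNorm_nonneg B θ p _
  · have h1 := decompNorm_smul_le hp (h c) c⁻¹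
    rw [inv_smul_smul₀ hc, norm_inv] at h1
    have hc' : 0 < ‖c‖ := norm_pos_iff.2 hc
    rwa [inv_mul_eq_div, le_div_iff₀ hc', mul_comm] at h1

/-- The triangle inequality follows from the convexity and the homogeneity of `decompInf`. -/
theorem decompNorm_add_le (hp : 1 ≤ p) (ha : B.decompInf θ p a ≠ ∞)
    (hb : B.decompInf θ p b ≠ ∞) :
    B.decompNorm θ p (a + b) ≤ B.decompNorm θ p a + B.decompNorm θ p b := by
  have hp0 : 0 < p := by linarith
  have key : ∀ r s : ℝ, B.decompNorm θ p a < r → B.decompNorm θ p b < s →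
      B.decompNorm θ p (a + b) ≤ r + s := by
    intro r s hr hs
    have hr0 : 0 < r := (decompNorm_nonneg B θ p a).trans_lt hr
    have hs0 : 0 < s := (decompNorm_nonneg B θ p b).trans_lt hs
    have hsmall : ∀ (x : V) (t : ℝ), 0 < t → B.decompInf θ p x ≠ ∞ → B.decompNorm θ p x < t →
        B.decompInf θ p (((t⁻¹ : ℝ) : 𝕜) • x) < 1 := by
      intro x t ht hx hxt
      refine (decompInf_smul_le B hp0 _ x).trans_lt ?_
      rw [decompInf_eq_ofReal hp0 hx, ← ofReal_norm,
        ENNReal.ofReal_rpow_of_nonneg (norm_nonneg _) hp0.le, RCLike.norm_ofReal,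
        abs_of_pos (by positivity), ← ENNReal.ofReal_mul (by positivity),
        ← Real.mul_rpow (by positivity) (decompNorm_nonneg B θ p x), ENNReal.ofReal_lt_one]
      refine Real.rpow_lt_one (mul_nonneg (by positivity) (decompNorm_nonneg B θ p x)) ?_ hp0
      rwa [inv_mul_lt_one₀ ht]
    set c : ℝ := r / (r + s) with hc
    set d : ℝ := s / (r + s) with hd
    have hcd : ‖(c : 𝕜)‖ₑ + ‖(d : 𝕜)‖ₑ = 1 := by
      rw [← ofReal_norm, ← ofReal_norm, RCLike.norm_ofReal, RCLike.norm_ofReal,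
        abs_of_pos (by positivity), abs_of_pos (by positivity),
        ← ENNReal.ofReal_add (by positivity) (by positivity), hc, hd, ← add_div,
        div_self (by positivity), ENNReal.ofReal_one]
    have h1 := decompInf_convex B hp hcd (hsmall a r hr0 ha hr) (hsmall b s hs0 hb hs)
    have e : a + b = ((r + s : ℝ) : 𝕜) • ((c : 𝕜) • ((r⁻¹ : ℝ) : 𝕜) • a +
        (d : 𝕜) • ((s⁻¹ : ℝ) : 𝕜) • b) := by
      rw [smul_smul, smul_smul, smul_add, smul_smul, smul_smul, ← RCLike.ofReal_mul,
        ← RCLike.ofReal_mul, ← RCLike.ofReal_mul, ← RCLike.ofReal_mul]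
      have e1 : (r + s) * (c * r⁻¹) = 1 := by rw [hc]; field_simp
      have e2 : (r + s) * (d * s⁻¹) = 1 := by rw [hd]; field_simp
      rw [e1, e2]
      simp
    have h2 : B.decompNorm θ p ((c : 𝕜) • ((r⁻¹ : ℝ) : 𝕜) • a +
        (d : 𝕜) • ((s⁻¹ : ℝ) : 𝕜) • b) ≤ 1 :=
      decompNorm_le_of_decompInf_le hp0 zero_le_one (by simpa using h1)
    rw [e]
    refine (decompNorm_smul_le hp0 (ne_top_of_le_ne_top ENNReal.one_ne_top h1) _).trans ?_
    rw [RCLike.norm_ofReal, abs_of_pos (by positivity)]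
    exact mul_le_of_le_one_right (by positivity) h2
  refine le_of_forall_pos_le_add fun ε hε => ?_
  have := key (B.decompNorm θ p a + ε / 2) (B.decompNorm θ p b + ε / 2)
    (by linarith) (by linarith)
  linarith

/-- The new norm as a seminorm on `B_{θ,p}`. -/
noncomputable def decompSeminorm [ContinuousAdd V] [T2Space V]
    (B : InterpolationCouple 𝕜 B₀ B₁ V) (hθ : 0 ≤ θ) (hp : 1 ≤ p) :
    Seminorm 𝕜 (B.realInterp θ p hp) :=
  Seminorm.of (fun a => B.decompNorm θ p (a : V))
    (fun a b => decompNorm_add_le hp (decompInf_ne_top hθ hp a.2) (decompInf_ne_top hθ hp b.2))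
    fun c a => decompNorm_smul (by linarith) c
      fun d => decompInf_ne_top hθ hp ((B.realInterp θ p hp).smul_mem d a.2)

/-- A bound between `p`-th powers gives a bound between the norms. -/
theorem exists_pos_toReal_rpow_le {M : ℝ≥0∞} (hM : M ≠ ∞) (hp : 0 < p) :
    ∃ C : ℝ, 0 < C ∧ ∀ x y : ℝ≥0∞, y ≠ ∞ → x ≤ M * y →
      x.toReal ^ (1 / p) ≤ C * y.toReal ^ (1 / p) := by
  refine ⟨(M.toReal + 1) ^ (1 / p), by positivity, fun x y hy h => ?_⟩
  rw [← Real.mul_rpow (by positivity) ENNReal.toReal_nonneg]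
  refine Real.rpow_le_rpow ENNReal.toReal_nonneg ?_ (by positivity)
  have h1 := ENNReal.toReal_mono (ENNReal.mul_ne_top hM hy) h
  rw [ENNReal.toReal_mul] at h1
  nlinarith [ENNReal.toReal_nonneg (a := y)]

theorem interpNorm_eq (hp : 1 ≤ p) (a : B.realInterp θ p hp) :
    B.interpNorm θ p hp a = (∫⁻ t in Set.Ioi (0 : ℝ),
      (B.K t a / ENNReal.ofReal (t ^ θ)) ^ p / ENNReal.ofReal t).toReal ^ (1 / p) := by
  rw [interpNorm, interpENorm, ENNReal.toReal_rpow]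

theorem decompNorm_equiv [ContinuousAdd V] [T2Space V]
    (B : InterpolationCouple 𝕜 B₀ B₁ V) (hθ : 0 ≤ θ) (hp : 1 ≤ p) :
    ∃ c C : ℝ, 0 < c ∧ 0 < C ∧ ∀ a : B.realInterp θ p hp,
      c * B.interpNorm θ p hp a ≤ B.decompNorm θ p (a : V) ∧
        B.decompNorm θ p (a : V) ≤ C * B.interpNorm θ p hp a := by
  have hp0 : 0 < p := by linarith
  have hw : ENNReal.ofReal (2 ^ θ) ^ p ≠ ∞ := ENNReal.rpow_ne_top_of_nonneg hp0.le (by simp)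
  have h2 : (2 : ℝ≥0∞) ^ p ≠ ∞ := ENNReal.rpow_ne_top_of_nonneg hp0.le (by simp)
  have h2' : (2 : ℝ≥0∞) ^ (p - 1) ≠ ∞ := ENNReal.rpow_ne_top_of_nonneg (by linarith) (by simp)
  obtain ⟨C₁, hC₁, H₁⟩ := exists_pos_toReal_rpow_le (ENNReal.mul_ne_top hw h2') hp0
  obtain ⟨C₂, hC₂, H₂⟩ := exists_pos_toReal_rpow_le
    (ENNReal.mul_ne_top h2 (ENNReal.mul_ne_top (ENNReal.ofNat_ne_top (n := 2)) hw)) hp0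
  refine ⟨C₁⁻¹, C₂, by positivity, hC₂, fun a => ⟨?_, ?_⟩⟩
  · rw [inv_mul_le_iff₀ hC₁, interpNorm_eq]
    refine H₁ _ _ (decompInf_ne_top hθ hp a.2) ?_
    rw [mul_assoc]
    refine (lintegral_K_le_dyadicSum B hθ hp0.le _).trans ?_
    gcongr
    exact dyadicSum_le_decompInf B θ hp _
  · rw [interpNorm_eq]
    refine H₂ _ _ ((interpENorm_lt_top_iff B θ hp _).1 a.2.2).ne ?_
    rw [mul_assoc]
    refine (decompInf_le_dyadicSum hp a.2.1).trans ?_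
    gcongr
    exact dyadicSum_le_lintegral_K B hθ hp0.le _

theorem eq_zero_of_decompNorm_eq_zero [ContinuousAdd V] [T2Space V] (hp : 1 ≤ p)
    (ha : B.decompInf θ p a ≠ ∞) (h : B.decompNorm θ p a = 0) : a = 0 := by
  have hp0 : 0 < p := by linarith
  have h1 : B.dyadicSum θ p a = 0 := by
    refine le_antisymm ((dyadicSum_le_decompInf B θ hp a).trans ?_) zero_le
    rw [decompInf_eq_ofReal hp0 ha, h, Real.zero_rpow hp0.ne']
    simp
  rw [dyadicSum, ENNReal.tsum_eq_zero] at h1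
  have h2 := h1 0
  refine eq_zero_of_K_eq_zero (B := B) one_pos ?_
  simpa [hp0, hp0.not_gt] using h2

/-! ### Uniform rotundity -/

/-- The core estimate. If near-optimal decompositions `u`, `v` of `a`, `b` have a midpoint that is
nearly as large, uniform convexity of `B₀` makes the `B₀`-part of `u - v` small, while its
`B₁`-part is merely bounded. Shifting `u - v` by a large `k` makes the `B₁`-part small too. -/
theorem exists_decompNorm_sub_rpow_le [UniformConvexSpace B₀] (B : InterpolationCouple 𝕜 B₀ B₁ V)
    (hθ : θ < 1) (hp : 1 < p) {η : ℝ} (hη : 0 < η) :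
    ∃ M : ℝ, 0 ≤ M ∧ ∀ a b : V, B.decompNorm θ p a = 1 → B.decompNorm θ p b = 1 →
      B.decompInf θ p (a + b) ≠ ∞ →
      B.decompNorm θ p (a - b) ^ p ≤ η + M * (1 - (B.decompNorm θ p (a + b) / 2) ^ p) := by
  have hp0 : 0 < p := by linarith
  have hpp : (0 : ℝ) < 2 ^ (p - 1) := by positivity
  -- The shift `k` brings the bounded `B₁`-part below `η / 2`.
  obtain ⟨k, hk⟩ : ∃ k : ℕ, ((2 : ℝ) ^ (-(1 - θ) * (k : ℤ))) ^ p * (2 ^ (p - 1) * 4) ≤ η / 2 := by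
    have hr : (2 : ℝ) ^ (-(1 - θ) * p) < 1 :=
      Real.rpow_lt_one_of_one_lt_of_neg one_lt_two (by nlinarith)
    obtain ⟨k, hk⟩ := exists_pow_lt_of_lt_one
      (show 0 < η / 2 / (2 ^ (p - 1) * 4) by positivity) hr
    refine ⟨k, ?_⟩
    rw [lt_div_iff₀ (by positivity), ← Real.rpow_natCast, ← Real.rpow_mul two_pos.le] at hk
    rw [← Real.rpow_mul two_pos.le]
    refine le_trans (le_of_eq ?_) hk.le
    congr 2
    push_cast
    ring
  set L : ℝ := ((2 : ℝ) ^ (θ * (k : ℤ))) ^ p with hL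
  have hL0 : 0 < L := by positivity
  obtain ⟨C, hC, H⟩ := exists_weightedSum_sub_add_le (𝕜 := 𝕜) (E := B₀) hp
    (show 0 < η / (8 * L) by positivity)
  set ε : ℝ := η / (8 * L) with hε
  have hLε : L * ε = η / 8 := by rw [hε]; field_simp
  have hε0 : 0 < ε := by positivity
  refine ⟨L * C, by positivity, fun a b ha hb hab => ?_⟩
  set q : ℝ := (B.decompNorm θ p (a + b) / 2) ^ p with hq
  have hq0 : 0 ≤ q := by
    have := decompNorm_nonneg B θ p (a + b)
    positivity
  have hhalf : ‖(2⁻¹ : 𝕜)‖ₑ = ENNReal.ofReal 2⁻¹ := by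
    rw [← ofReal_norm, norm_inv, RCLike.norm_two]
  have hqle : ENNReal.ofReal q ≤ B.decompInf θ p ((2⁻¹ : 𝕜) • (a + b)) := by
    have hne : B.decompInf θ p ((2⁻¹ : 𝕜) • (a + b)) ≠ ∞ :=
      ne_top_of_le_ne_top (ENNReal.mul_ne_top (ENNReal.rpow_ne_top_of_nonneg hp0.le enorm_ne_top)
        hab) (decompInf_smul_le B hp0 _ _)
    rw [decompInf_eq_ofReal hp0 hne]
    have h := decompNorm_smul_le hp0 hne (2 : 𝕜)
    rw [smul_inv_smul₀ two_ne_zero, RCLike.norm_two] at h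
    have h0 := decompNorm_nonneg B θ p (a + b)
    exact ENNReal.ofReal_le_ofReal (Real.rpow_le_rpow (by positivity) (by linarith) hp0.le)
  have hone : ∀ x : V, B.decompNorm θ p x = 1 → ∀ δ : ℝ, 0 < δ →
      ∃ u, B.IsDecomp u x ∧ pairSum θ p u < ENNReal.ofReal (1 + δ) := by
    intro x hx δ hδ
    have hx' : (B.decompInf θ p x).toReal = 1 := by
      rw [← decompNorm_rpow B θ hp0, hx, Real.one_rpow]
    refine exists_isDecomp_lt ?_
    rw [(ENNReal.toReal_eq_one_iff _).1 hx', ← ENNReal.ofReal_one]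
    exact (ENNReal.ofReal_lt_ofReal_iff (by linarith)).2 (by linarith)
  have key : ∀ δ : ℝ, 0 < δ → δ ≤ 1 →
      B.decompNorm θ p (a - b) ^ p ≤ η + L * C * (1 - q) + L * C * δ := by
    intro δ hδ hδ1
    obtain ⟨u, hu, hu'⟩ := hone a ha δ hδ
    obtain ⟨v, hv, hv'⟩ := hone b hb δ hδ
    have hsum : pairSum θ p u + pairSum θ p v ≤ ENNReal.ofReal (2 * (1 + δ)) := by
      rw [two_mul, ENNReal.ofReal_add (by linarith) (by linarith)]
      exact add_le_add hu'.le hv'.le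
    set u₀ : ℤ → B₀ := fun n => (u n).1
    set u₁ : ℤ → B₁ := fun n => (u n).2
    set v₀ : ℤ → B₀ := fun n => (v n).1
    set v₁ : ℤ → B₁ := fun n => (v n).2
    have hU : pairSum θ p u = weightedSum p (-θ) u₀ + weightedSum p (1 - θ) u₁ := rfl
    have hV : pairSum θ p v = weightedSum p (-θ) v₀ + weightedSum p (1 - θ) v₁ := rfl
    have hmid : ENNReal.ofReal q ≤ weightedSum p (-θ) ((2⁻¹ : 𝕜) • (u₀ + v₀)) +
        weightedSum p (1 - θ) ((2⁻¹ : 𝕜) • (u₁ + v₁)) :=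
      hqle.trans (decompInf_le ((hu.add hv).smul 2⁻¹))
    have h₀ := H (-θ) u₀ v₀
    have h₁ : ENNReal.ofReal C * weightedSum p (1 - θ) ((2⁻¹ : 𝕜) • (u₁ + v₁)) ≤
        ENNReal.ofReal (ε + C / 2) * (weightedSum p (1 - θ) u₁ + weightedSum p (1 - θ) v₁) := by
      have h := weightedSum_convex (𝕜 := 𝕜) (c := 2⁻¹) (d := 2⁻¹) hp.le (1 - θ) (by
        rw [hhalf, ← ENNReal.ofReal_add (by norm_num) (by norm_num)]
        norm_num) u₁ v₁
      rw [← smul_add, ← mul_add, hhalf] at h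
      calc _ ≤ ENNReal.ofReal C * (ENNReal.ofReal 2⁻¹ *
            (weightedSum p (1 - θ) u₁ + weightedSum p (1 - θ) v₁)) := by gcongr
        _ ≤ _ := by
          rw [← mul_assoc, ← ENNReal.ofReal_mul hC]
          gcongr
          linarith
    have h₂ : weightedSum p (-θ) (u₀ - v₀) + ENNReal.ofReal (C * q) ≤
        ENNReal.ofReal ((ε + C / 2) * (2 * (1 + δ))) := by
      calc weightedSum p (-θ) (u₀ - v₀) + ENNReal.ofReal (C * q)
          ≤ weightedSum p (-θ) (u₀ - v₀) + ENNReal.ofReal C *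
              (weightedSum p (-θ) ((2⁻¹ : 𝕜) • (u₀ + v₀)) +
                weightedSum p (1 - θ) ((2⁻¹ : 𝕜) • (u₁ + v₁))) := by
            rw [ENNReal.ofReal_mul hC]
            gcongr
        _ ≤ ENNReal.ofReal (ε + C / 2) * (pairSum θ p u + pairSum θ p v) := by
            rw [hU, hV, mul_add, ← add_assoc]
            refine (add_le_add h₀ h₁).trans (le_of_eq ?_)
            ring
        _ ≤ _ := by
            rw [ENNReal.ofReal_mul (by positivity)]
            gcongr
    have hCq : C * q ≤ (ε + C / 2) * (2 * (1 + δ)) :=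
      (ENNReal.ofReal_le_ofReal_iff (by positivity)).1 (le_add_self.trans h₂)
    have h₃ : weightedSum p (-θ) (u₀ - v₀) ≤
        ENNReal.ofReal ((ε + C / 2) * (2 * (1 + δ)) - C * q) := by
      rw [ENNReal.ofReal_sub _ (by positivity)]
      exact ENNReal.le_sub_of_add_le_right ENNReal.ofReal_ne_top h₂
    have h₄ : weightedSum p (1 - θ) (u₁ - v₁) ≤ ENNReal.ofReal (2 ^ (p - 1) * 4) := by
      refine (weightedSum_sub_le hp.le _ _ _).trans ?_
      rw [ENNReal.ofReal_mul hpp.le, ← ENNReal.ofReal_rpow_of_pos two_pos, ENNReal.ofReal_ofNat]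
      gcongr
      calc _ ≤ pairSum θ p u + pairSum θ p v := by
            rw [hU, hV]
            exact add_le_add le_add_self le_add_self
        _ ≤ ENNReal.ofReal (2 * (1 + δ)) := hsum
        _ ≤ ENNReal.ofReal 4 := ENNReal.ofReal_le_ofReal (by linarith)
    have h₅ : B.decompInf θ p (a - b) ≤
        ENNReal.ofReal (L * ((ε + C / 2) * (2 * (1 + δ)) - C * q) + η / 2) := by
      refine (decompInf_le ((hu.sub hv).shift (k : ℤ))).trans ?_
      calc pairSum θ p (fun n => (u - v) (n + (k : ℤ)))
          = weightedSum p (-θ) (fun n => (u₀ - v₀) (n + (k : ℤ))) +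
            weightedSum p (1 - θ) (fun n => (u₁ - v₁) (n + (k : ℤ))) := rfl
        _ = ENNReal.ofReal L * weightedSum p (-θ) (u₀ - v₀) +
            ENNReal.ofReal (((2 : ℝ) ^ (-(1 - θ) * (k : ℤ))) ^ p) *
              weightedSum p (1 - θ) (u₁ - v₁) := by
            rw [weightedSum_shift hp0.le, weightedSum_shift hp0.le, neg_neg,
              ENNReal.ofReal_rpow_of_pos (by positivity),
              ENNReal.ofReal_rpow_of_pos (by positivity)]
        _ ≤ ENNReal.ofReal L * ENNReal.ofReal ((ε + C / 2) * (2 * (1 + δ)) - C * q) +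
            ENNReal.ofReal (((2 : ℝ) ^ (-(1 - θ) * (k : ℤ))) ^ p) *
              ENNReal.ofReal (2 ^ (p - 1) * 4) := by gcongr
        _ ≤ _ := by
            rw [← ENNReal.ofReal_mul hL0.le, ← ENNReal.ofReal_mul (by positivity),
              ENNReal.ofReal_add (mul_nonneg hL0.le (by linarith)) (by positivity)]
            gcongr
    rw [decompNorm_rpow B θ hp0]
    refine (ENNReal.toReal_le_of_le_ofReal (add_nonneg (mul_nonneg hL0.le (by linarith))
      (by positivity)) h₅).trans ?_
    have e : L * ((ε + C / 2) * (2 * (1 + δ)) - C * q) + η / 2 =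
        L * ε * (2 * (1 + δ)) + L * C * (1 - q) + L * C * δ + η / 2 := by ring
    rw [e, hLε]
    nlinarith
  refine le_of_forall_pos_le_add fun e he => ?_
  have hLC : 0 ≤ L * C := by positivity
  refine (key (min 1 (e / (L * C + 1))) (by positivity) (min_le_left _ _)).trans ?_
  have h1 : L * C * min 1 (e / (L * C + 1)) ≤ (L * C + 1) * (e / (L * C + 1)) :=
    mul_le_mul (by linarith) (min_le_right _ _) (by positivity) (by positivity)
  rw [mul_div_cancel₀ _ (by positivity)] at h1
  linarith

theorem uniformlyRotund_decompSeminorm [ContinuousAdd V] [T2Space V] [UniformConvexSpace B₀]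
    (B : InterpolationCouple 𝕜 B₀ B₁ V) (hθ₀ : 0 ≤ θ) (hθ₁ : θ < 1) (hp : 1 < p) :
    UniformlyRotund (B.decompSeminorm hθ₀ hp.le) := by
  have hp0 : 0 < p := by linarith
  intro x y hx hy hxy
  rw [Metric.tendsto_atTop]
  intro ε hε
  obtain ⟨M, hM, H⟩ := exists_decompNorm_sub_rpow_le B hθ₁ hp
    (show 0 < ε ^ p / 2 by positivity)
  have hlim : Filter.Tendsto
      (fun n => M * (1 - (B.decompSeminorm hθ₀ hp.le (x n + y n) / 2) ^ p))
      Filter.atTop (nhds 0) := by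
    have h := ((hxy.div_const 2).rpow_const (p := p) (Or.inr hp0.le)).const_sub 1 |>.const_mul M
    simpa using h
  obtain ⟨n₀, hn₀⟩ := Filter.eventually_atTop.1
    (hlim.eventually_lt_const (show 0 < ε ^ p / 2 by positivity))
  refine ⟨n₀, fun n hn => ?_⟩
  rw [Real.dist_eq, sub_zero, abs_of_nonneg (apply_nonneg _ _)]
  have h1 := H (x n) (y n) (hx n) (hy n) (decompInf_ne_top hθ₀ hp.le (x n + y n).2)
  have h2 : M * (1 - (B.decompNorm θ p ((x n : V) + y n) / 2) ^ p) < ε ^ p / 2 := hn₀ n hn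
  have h3 : B.decompNorm θ p ((x n : V) - y n) ^ p < ε ^ p := by linarith
  exact (Real.rpow_lt_rpow_iff (decompNorm_nonneg B θ p _) hε.le hp0).1 h3

end InterpolationCouple

theorem mainTheorem4 {𝕜 B₀ B₁ V : Type*} [RCLike 𝕜]
    [NormedAddCommGroup B₀] [NormedSpace 𝕜 B₀] [CompleteSpace B₀]
    [NormedAddCommGroup B₁] [NormedSpace 𝕜 B₁] [CompleteSpace B₁]
    [AddCommGroup V] [Module 𝕜 V] [TopologicalSpace V] [IsTopologicalAddGroup V]
    [ContinuousSMul 𝕜 V] [T2Space V]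
    (B : InterpolationCouple 𝕜 B₀ B₁ V) (hB₀ : UniformlyRotund (normSeminorm 𝕜 B₀))
    (θ p : ℝ) (hθ₀ : 0 < θ) (hθ₁ : θ < 1) (hp : 1 < p) :
    ∃ N : Seminorm 𝕜 (B.realInterp θ p hp.le),
      (∀ a, N a = 0 → a = 0) ∧
      (∃ c C : ℝ, 0 < c ∧ 0 < C ∧
        ∀ a, c * B.interpNorm θ p hp.le a ≤ N a ∧ N a ≤ C * B.interpNorm θ p hp.le a) ∧
      UniformlyRotund N := by
  have : UniformConvexSpace B₀ := uniformlyRotund_normSeminorm_iff.1 hB₀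
  exact ⟨B.decompSeminorm hθ₀.le hp.le,
    fun a ha => Subtype.ext (InterpolationCouple.eq_zero_of_decompNorm_eq_zero hp.le
      (InterpolationCouple.decompInf_ne_top hθ₀.le hp.le a.2) ha),
    B.decompNorm_equiv hθ₀.le hp.le, B.uniformlyRotund_decompSeminorm hθ₀.le hθ₁ hp⟩
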